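/- Let $q>2$ be a prime power, $R_T=\mathbb F_q[T]$, $k=\mathbb F_q(T)$, and let $\overline k$ be an algebraic closure of $k$. For $M\in R_T$ and $u\in\overline k$ let $u^M:=M(\varphi+\mu_T)(u)$ be the Carlitz--Hayes action, where $\varphi(u)=u^q$ and $\mu_T(u)=Tu$, and for $M\neq 0$ let $\Lambda_M=\{u\in\overline k : u^M=0\}$ be the set of Carlitz $M$-roots. For fields $k\subseteq K\subseteq L\subseteq\overline k$, the extension $L/K$ is called \emph{radical} if $L=K(A)$ for some subset $A$ of $T(L/K)=\{u\in L : u^M\in K\text{ for some } M\in R_T\setminus\{0\}\}$; it is called \emph{pure} if for every monic irreducible $Q\in R_T$, every $u\in L$ with $u^Q=0$ lies in $K$; and it is called \emph{radical cyclotomic} if it is radical, separable and pure. Let $P\in R_T$ be monic and irreducible, and let $n\ge 1$ be an integer. Then $k(\Lambda_P)\subseteq k(\Lambda_{P^n})$, and the extension $k(\Lambda_{P^n})/k(\Lambda_P)$ is pure. Hence it is a radical cyclotomic extension. -/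

import Mathlib

open Polynomial

/-! Throughout, `F` is the finite field `𝔽_q`, `F[X]` is `R_T = 𝔽_q[T]`, `RatFunc F` is `k = 𝔽_q(T)`,
and `Ω` is an extension field of `k` (in the theorem: an algebraic closure of `k`). The scalar tower
says that the `F`-algebra structure of `Ω` is the one coming from `k`. -/

noncomputable section

namespace CarlitzHayes

section Action

variable (F : Type*) [Field F] [Fintype F]
variable (Ω : Type*) [Field Ω] [Algebra F Ω] [Algebra (RatFunc F) Ω] [IsScalarTower F (RatFunc F) Ω]

/-- The Frobenius `φ(u) = u ^ q`, as an `𝔽_q`-linear endomorphism of `Ω`. -/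
def frob : Module.End F Ω := (FiniteField.frobeniusAlgHom F Ω).toLinearMap

/-- Multiplication by `T`, `μ_T(u) = T u`, as an `𝔽_q`-linear endomorphism of `Ω`. -/
def mulT : Module.End F Ω := LinearMap.mulLeft F (algebraMap (RatFunc F) Ω RatFunc.X)

variable {F Ω}

/-- The Carlitz-Hayes action `u ^ M = M(φ + μ_T)(u)`. -/
def act (M : F[X]) (u : Ω) : Ω := aeval (frob F Ω + mulT F Ω) M u

variable (Ω)

/-- The set `Λ_M` of Carlitz `M`-roots in `Ω`. -/
def carlitzRoots (M : F[X]) : Set Ω := {u | act M u = 0}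

/-- The cyclotomic function field `k(Λ_M)`, as a subfield of `Ω`. -/
def cyclotomicField (M : F[X]) : IntermediateField (RatFunc F) Ω :=
  IntermediateField.adjoin (RatFunc F) (carlitzRoots Ω M)

end Action

section Extensions

variable {F : Type*} [Field F] [Fintype F]
variable {Ω : Type*} [Field Ω] [Algebra F Ω] [Algebra (RatFunc F) Ω] [IsScalarTower F (RatFunc F) Ω]

/-- The torsion `T(L/K)`: the elements `u ∈ L` with `u ^ M ∈ K` for some nonzero `M`. -/
def torsion (K L : IntermediateField (RatFunc F) Ω) : Set Ω :=
  {u | u ∈ L ∧ ∃ M : F[X], M ≠ 0 ∧ act M u ∈ K}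

/-- `L/K` is radical: `L = K(A)` for some `A ⊆ T(L/K)`. -/
def IsRadical (K L : IntermediateField (RatFunc F) Ω) : Prop :=
  ∃ A : Set Ω, A ⊆ torsion K L ∧
    L = (IntermediateField.adjoin K A).restrictScalars (RatFunc F)

/-- `L/K` is pure: for every monic irreducible `Q`, each Carlitz `Q`-root in `L` lies in `K`. -/
def IsPure (K L : IntermediateField (RatFunc F) Ω) : Prop :=
  ∀ Q : F[X], Q.Monic → Irreducible Q → ∀ u ∈ L, act Q u = 0 → u ∈ K

/-- `L/K` is a radical cyclotomic extension: an extension that is radical, separable and pure. -/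
structure IsRadicalCyclotomic (K L : IntermediateField (RatFunc F) Ω) : Prop where
  le : K ≤ L
  radical : IsRadical K L
  separable : Algebra.IsSeparable K (IntermediateField.extendScalars le)
  pure : IsPure K L

end Extensions

end CarlitzHayes

end

/-! A Carlitz `Q`-root in `k(Λ_{P^n})` with `Q = P` lies in `Λ_P`, so purity amounts to showing that
for `Q ≠ P` such a root `u` is zero. This is a ramification argument at `Q`.

If `u ≠ 0`, cancelling `u` in its Carlitz equation leaves an Eisenstein equation at `Q` of degree `q
^ deg Q - 1`, because `Q` divides all lower coefficients (`dvd_carlitzCoeff`). Since `q > 2`, this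
degree is at least 2, which forces ramification above `Q`. But `k(Λ_{P^n})` is generated by one root
of a monic polynomial with derivative `P ^ n`, so its different contains `P ^ n` and no prime above
`Q` ramifies. `not_eisenstein_root_of_derivative_eq_C` is this contradiction.

Radicality and separability hold because `Λ_{P^n}` generates the field and consists of roots of a
separable polynomial. -/

noncomputable section

namespace CarlitzHayes

/-! ### The different against Eisenstein equations. -/

section Ramification

variable {A : Type*} [CommRing A] [IsDedekindDomain A]
variable {K : Type*} [Field K] [Algebra A K] [IsFractionRing A K]
variable {L : Type*} [Field L] [Algebra K L] [Algebra A L] [IsScalarTower A K L]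

/-- If `L = K(x)` for a root `x` of a monic polynomial whose derivative is a constant outside the
prime `(Q)`, then `L` contains no root of a `(Q)`-Eisenstein equation of degree at least two. -/
theorem not_eisenstein_root_of_derivative_eq_C [FiniteDimensional K L] [Algebra.IsSeparable K L]
    {Q c : A} (hQ : Prime Q) (hQc : ¬ Q ∣ c) {f : A[X]} (hf : f.Monic)
    (hfd : derivative f = C c) {x : L} (hx : aeval x f = 0)
    (hxL : IntermediateField.adjoin K {x} = ⊤)
    {u w : L} (hu : IsIntegral A u) (hw : IsIntegral A w) {m : ℕ} (hm : 2 ≤ m) :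
    u ^ m + algebraMap A L Q * (1 + u * w) ≠ 0 := by
  intro h
  let B := integralClosure A L
  have : Module.Finite A B := IsIntegralClosure.finite A K L B
  have : IsDedekindDomain B := integralClosure.isDedekindDomain A K L
  have : IsFractionRing B L := integralClosure.isFractionRing_of_finite_extension K L
  have : FaithfulSMul A L := by
    rw [faithfulSMul_iff_algebraMap_injective, IsScalarTower.algebraMap_eq A K L]
    exact (algebraMap K L).injective.comp (IsFractionRing.injective A K)
  have : Module.IsTorsionFree A L := inferInstance
  have : Module.IsTorsionFree A B := inferInstance
  have : FaithfulSMul A B := inferInstance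
  have hxi : IsIntegral A x := ⟨f, hf, by rwa [← aeval_def]⟩
  let x' : B := ⟨x, hxi⟩
  let u' : B := ⟨u, hu⟩
  let w' : B := ⟨w, hw⟩
  have hinj : Function.Injective (algebraMap B L) := Subtype.val_injective
  have hx' : aeval x' f = 0 := by
    apply hinj
    rw [← aeval_algebraMap_apply, map_zero]
    exact hx
  have h' : u' ^ m + algebraMap A B Q * (1 + u' * w') = 0 := by
    apply hinj
    simpa [B] using h
  have : (Ideal.span {Q}).IsPrime := (Ideal.span_singleton_prime hQ.ne_zero).2 hQ
  have : (Ideal.span {Q}).IsMaximal := Ideal.IsPrime.isMaximal this (by simpa using hQ.ne_zero)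
  obtain ⟨q, hqm, hqo⟩ := Ideal.exists_maximal_ideal_liesOver_of_isIntegral (S := B)
    (Ideal.span {Q})
  have hqmem (a : A) : algebraMap A B a ∈ q ↔ Q ∣ a := by
    rw [← Ideal.mem_span_singleton, hqo.over, Ideal.mem_comap]
  have hcd : algebraMap A B c ∈ differentIdeal A B := by
    have hadj : Algebra.adjoin K {algebraMap B L x'} = ⊤ := by
      change Algebra.adjoin K {x} = ⊤
      rw [← IntermediateField.adjoin_simple_toSubalgebra_of_isAlgebraic
        (Algebra.IsAlgebraic.isAlgebraic x), hxL, IntermediateField.top_toSubalgebra]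
    have hmem := aeval_derivative_mem_differentIdeal A K L x' hadj
    -- Writing `f = minpoly * g`, the product rule at the root gives `c = minpoly'(x) g(x)`, and
    -- `minpoly'(x)` lies in the different.
    obtain ⟨g, hg⟩ := minpoly.isIntegrallyClosed_dvd (Algebra.IsIntegral.isIntegral x') hx'
    have : algebraMap A B c = aeval x' (derivative (minpoly A x')) * aeval x' g := by
      rw [← aeval_C (R := A) x', ← hfd, hg]
      simp
    rw [this]
    exact Ideal.mul_mem_right _ _ hmem
  have huq : u' ∈ q := by
    refine hqm.isPrime.mem_of_pow_mem m ?_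
    rw [eq_neg_of_add_eq_zero_left h']
    exact neg_mem (Ideal.mul_mem_right _ _ ((hqmem Q).2 dvd_rfl))
  have h1 : 1 + u' * w' ∉ q := fun h1 => hqm.ne_top <| (Ideal.eq_top_iff_one q).2 <| by
    simpa using sub_mem h1 (Ideal.mul_mem_right w' q huq)
  -- `u ^ m` lies in `q ^ 2` and `1 + u w` is a unit modulo `q`.
  have hQ2 : algebraMap A B Q ∈ q ^ 2 := by
    have : algebraMap A B Q * (1 + u' * w') ∈ q ^ 2 := by
      rw [eq_neg_of_add_eq_zero_right h']
      exact neg_mem (Ideal.pow_le_pow_right hm (Ideal.pow_mem_pow huq m))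
    rw [mul_comm] at this
    exact (Ideal.IsMaximal.mul_mem_pow q this).resolve_left h1
  have hdvd : q ^ 2 ∣ (Ideal.span {Q}).map (algebraMap A B) := by
    rw [Ideal.dvd_iff_le, Ideal.map_span, Set.image_singleton,
      Ideal.span_singleton_le_iff_mem]
    exact hQ2
  have := pow_sub_one_dvd_differentIdeal_aux A K L q two_ne_zero (by simpa using hQ.ne_zero) hdvd
  rw [pow_one, Ideal.dvd_iff_le] at this
  exact hQc ((hqmem c).1 (this hcd))

end Ramification

/-! ### Coefficients of the Carlitz polynomials, computed with twisted polynomials. -/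

section Coefficients

variable (F : Type*) [Field F] [Fintype F]

/-- Left composition with `φ + μ_T` on coefficient sequences of `∑ cᵢ φⁱ`. -/
def leftMulT : Module.End F (ℕ → F[X]) where
  toFun c i := X * c i + match i with
    | 0 => 0
    | j + 1 => FiniteField.frobeniusAlgHom F F[X] (c j)
  map_add' c d := by
    ext1 i
    cases i <;> simp only [Pi.add_apply, map_add] <;> ring
  map_smul' a c := by
    ext1 i
    cases i <;> simp only [Pi.smul_apply, map_smul, RingHom.id_apply, smul_add, smul_zero,
      mul_smul_comm]

/-- Right composition with `φ + μ_T` on coefficient sequences of `∑ cᵢ φⁱ`. -/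
def rightMulT : Module.End F (ℕ → F[X]) where
  toFun c i := X ^ Fintype.card F ^ i * c i + match i with
    | 0 => 0
    | j + 1 => c j
  map_add' c d := by
    ext1 i
    cases i <;> simp only [Pi.add_apply] <;> ring
  map_smul' a c := by
    ext1 i
    cases i <;> simp only [Pi.smul_apply, RingHom.id_apply, smul_add, smul_zero, mul_smul_comm]

variable {F}

theorem leftMulT_zero (c : ℕ → F[X]) : leftMulT F c 0 = X * c 0 := by simp [leftMulT]

theorem leftMulT_succ (c : ℕ → F[X]) (i : ℕ) :
    leftMulT F c (i + 1) = X * c (i + 1) + c i ^ Fintype.card F := rfl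

theorem rightMulT_zero (c : ℕ → F[X]) : rightMulT F c 0 = X * c 0 := by simp [rightMulT]

theorem rightMulT_succ (c : ℕ → F[X]) (i : ℕ) :
    rightMulT F c (i + 1) = X ^ Fintype.card F ^ (i + 1) * c (i + 1) + c i := rfl

theorem add_pow_card {R : Type*} [CommRing R] [Algebra F R] (a b : R) :
    (a + b) ^ Fintype.card F = a ^ Fintype.card F + b ^ Fintype.card F :=
  map_add (FiniteField.frobeniusAlgHom F R) a b

/-- Associativity in the twisted polynomial ring, where `φ a = a ^ q φ`, checked on coefficients. -/
theorem commute_leftMulT_rightMulT : Commute (leftMulT F) (rightMulT F) := by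
  refine LinearMap.ext fun c => funext fun i => ?_
  simp only [Module.End.mul_apply]
  rcases i with _ | _ | i
  · simp only [leftMulT_zero, rightMulT_zero]
  · simp only [leftMulT_zero, rightMulT_zero, leftMulT_succ, rightMulT_succ, mul_pow]
    ring
  · simp only [leftMulT_succ, rightMulT_succ, mul_pow, add_pow_card]
    ring

/-- The coefficients `[M, i]` in `u ^ M = ∑ [M, i] u ^ (q ^ i)`. -/
def carlitzCoeff (M : F[X]) : ℕ → F[X] := aeval (leftMulT F) M (Pi.single 0 1)

theorem carlitzCoeff_add (M N : F[X]) : carlitzCoeff (M + N) = carlitzCoeff M + carlitzCoeff N := by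
  simp [carlitzCoeff]

theorem carlitzCoeff_C (a : F) : carlitzCoeff (C a) = Pi.single (0 : ℕ) (C a) := by
  ext1 i
  rcases eq_or_ne i 0 with rfl | hi
  · simp [carlitzCoeff, Module.algebraMap_end_apply, smul_eq_C_mul]
  · simp [carlitzCoeff, Module.algebraMap_end_apply, hi]

theorem carlitzCoeff_X_mul (M : F[X]) : carlitzCoeff (X * M) = leftMulT F (carlitzCoeff M) := by
  simp [carlitzCoeff, Module.End.mul_apply]

/-- `M(φ + T)` commutes with `φ + T`: both multiplications agree on `1`, and each commutes with
`aeval (leftMulT F) M`. -/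
theorem leftMulT_carlitzCoeff (M : F[X]) :
    leftMulT F (carlitzCoeff M) = rightMulT F (carlitzCoeff M) := by
  have h1 : leftMulT F (Pi.single 0 1) = rightMulT F (Pi.single 0 1) := by
    ext1 i
    rcases i with _ | _ | i <;>
      simp [leftMulT_zero, rightMulT_zero, leftMulT_succ, rightMulT_succ]
  have h2 : Commute (aeval (leftMulT F) M) (rightMulT F) :=
    Polynomial.induction_on M (fun a => by rw [aeval_C]; exact Algebra.commutes a (rightMulT F))
      (fun p q hp hq => by simpa using hp.add_left hq)
      (fun n a _ => by
        simpa using Commute.mul_left (Algebra.commutes a (rightMulT F))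
          (commute_leftMulT_rightMulT.pow_left (n + 1)))
  have h3 : Commute (aeval (leftMulT F) M) (leftMulT F) := by
    simpa using ((commute_X M).symm.map (aeval (leftMulT F)))
  calc leftMulT F (carlitzCoeff M)
      = (leftMulT F * aeval (leftMulT F) M) (Pi.single 0 1) := rfl
    _ = aeval (leftMulT F) M (leftMulT F (Pi.single 0 1)) := by rw [← h3.eq]; rfl
    _ = (aeval (leftMulT F) M * rightMulT F) (Pi.single 0 1) := by rw [h1]; rfl
    _ = rightMulT F (carlitzCoeff M) := by rw [h2.eq]; rfl

theorem carlitzCoeff_recursion (M : F[X]) (i : ℕ) :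
    (X ^ Fintype.card F ^ (i + 1) - X) * carlitzCoeff M (i + 1) =
      carlitzCoeff M i ^ Fintype.card F - carlitzCoeff M i := by
  have := congrFun (leftMulT_carlitzCoeff M) (i + 1)
  rw [leftMulT_succ, rightMulT_succ] at this
  linear_combination -this

theorem carlitzCoeff_eq_of_divX (M : F[X]) :
    carlitzCoeff M = leftMulT F (carlitzCoeff M.divX) + Pi.single (0 : ℕ) (C (M.coeff 0)) := by
  conv_lhs => rw [← X_mul_divX_add M]
  rw [carlitzCoeff_add, carlitzCoeff_X_mul, carlitzCoeff_C]

theorem carlitzCoeff_zero_right (M : F[X]) : carlitzCoeff M 0 = M := by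
  induction M using Polynomial.induction_on' with
  | add p q hp hq => simp [carlitzCoeff_add, hp, hq]
  | monomial n a =>
    induction n with
    | zero => simp [carlitzCoeff_C]
    | succ n ih =>
      rw [← X_mul_monomial, carlitzCoeff_X_mul, leftMulT_zero, ih]

theorem carlitzCoeff_of_natDegree_le {M : F[X]} {n i : ℕ} (h : M.natDegree ≤ n) (hi : n ≤ i) :
    carlitzCoeff M i = C (M.coeff i) := by
  induction n generalizing M i with
  | zero =>
    rw [eq_C_of_natDegree_le_zero h, carlitzCoeff_C]
    rcases eq_or_ne i 0 with rfl | hi'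
    · simp
    · simp [hi', coeff_C_of_ne_zero hi']
  | succ n ih =>
    obtain ⟨j, rfl⟩ : ∃ j, i = j + 1 := ⟨i - 1, by omega⟩
    have hd : M.divX.natDegree ≤ n := by rw [natDegree_divX_eq_natDegree_tsub_one]; omega
    rw [carlitzCoeff_eq_of_divX, Pi.add_apply, leftMulT_succ, ih hd (by omega : n ≤ j + 1),
      ih hd (by omega : n ≤ j), ← C_pow, FiniteField.pow_card, coeff_divX, coeff_divX,
      coeff_eq_zero_of_natDegree_lt (by omega : M.natDegree < j + 1 + 1)]
    simp

/-- For `Q` irreducible, `[Q, i]` is divisible by `Q` for every `i < deg Q`. -/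
theorem dvd_carlitzCoeff {Q : F[X]} (hQ : Irreducible Q) {i : ℕ} (hi : i < Q.natDegree) :
    Q ∣ carlitzCoeff Q i := by
  induction i with
  | zero => rw [carlitzCoeff_zero_right]
  | succ i ih =>
    have h1 : Q ∣ (X ^ Fintype.card F ^ (i + 1) - X) * carlitzCoeff Q (i + 1) := by
      rw [carlitzCoeff_recursion]
      have := ih (by omega)
      exact dvd_sub (this.trans (dvd_pow_self _ Fintype.card_ne_zero)) this
    -- An irreducible factor of `X ^ q ^ (i + 1) - X` has degree dividing `i + 1`, which is less
    -- than `deg Q`.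
    refine (hQ.prime.dvd_or_dvd h1).resolve_left fun h2 => ?_
    rw [← Nat.card_eq_fintype_card] at h2
    exact absurd (Nat.le_of_dvd i.succ_pos (hQ.natDegree_dvd_of_dvd_X_pow_card_pow_sub_X h2))
      (by omega)

/-- The polynomial `∑ [M, i] Y ^ (q ^ i)` over `𝔽_q[T]` whose values are `u ^ M`. -/
def carlitzPoly (M : F[X]) : F[X][X] :=
  ∑ i ∈ Finset.range (M.natDegree + 1), C (carlitzCoeff M i) * X ^ Fintype.card F ^ i

/-- Every exponent `q ^ i` with `i > 0` vanishes in `F`, so only the linear term survives. -/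
theorem derivative_carlitzPoly (M : F[X]) : derivative (carlitzPoly M) = C M := by
  rw [carlitzPoly, derivative_sum, Finset.sum_eq_single 0]
  · simp [carlitzCoeff_zero_right]
  · intro i _ hi
    have : ((Fintype.card F : ℕ) : F[X]) = 0 := by
      rw [← map_natCast C, FiniteField.cast_card_eq_zero, map_zero]
    simp [derivative_X_pow, hi, this]
  · simp

theorem degree_carlitzPoly_sum_lt (M : F[X]) (n : ℕ) :
    (∑ i ∈ Finset.range n, C (carlitzCoeff M i) * X ^ Fintype.card F ^ i).degree <
      ((Fintype.card F ^ n : ℕ) : WithBot ℕ) := by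
  rw [degree_lt_iff_coeff_zero]
  intro m hm
  rw [finsetSum_coeff]
  refine Finset.sum_eq_zero fun i hi => ?_
  have : Fintype.card F ^ i < Fintype.card F ^ n :=
    Nat.pow_lt_pow_right Fintype.one_lt_card (Finset.mem_range.1 hi)
  rw [coeff_C_mul_X_pow, if_neg (by omega)]

theorem carlitzPoly_eq_of_monic {M : F[X]} (hM : M.Monic) :
    carlitzPoly M = X ^ Fintype.card F ^ M.natDegree +
      ∑ i ∈ Finset.range M.natDegree, C (carlitzCoeff M i) * X ^ Fintype.card F ^ i := by
  rw [carlitzPoly, Finset.sum_range_succ, carlitzCoeff_of_natDegree_le le_rfl le_rfl, coeff_natDegree,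
    hM.leadingCoeff, add_comm]
  simp

theorem monic_carlitzPoly {M : F[X]} (hM : M.Monic) : (carlitzPoly M).Monic := by
  rw [carlitzPoly_eq_of_monic hM]
  exact monic_X_pow_add (degree_carlitzPoly_sum_lt M _)

theorem natDegree_carlitzPoly {M : F[X]} (hM : M.Monic) :
    (carlitzPoly M).natDegree = Fintype.card F ^ M.natDegree := by
  rw [carlitzPoly_eq_of_monic hM]
  refine natDegree_eq_of_degree_eq_some ?_
  rw [degree_add_eq_left_of_degree_lt] <;> rw [degree_X_pow]
  exact degree_carlitzPoly_sum_lt M _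

end Coefficients

/-! ### The Carlitz action and the module structure of its roots. -/

section Roots

variable {F : Type*} [Field F] [Fintype F]
variable {Ω : Type*} [Field Ω] [Algebra F Ω] [Algebra (RatFunc F) Ω]

theorem act_C (a : F) (u : Ω) : act (C a) u = algebraMap F Ω a * u := by
  simp [act, Module.algebraMap_end_apply, Algebra.smul_def]

theorem act_X (u : Ω) :
    act (X : F[X]) u = u ^ Fintype.card F + algebraMap (RatFunc F) Ω RatFunc.X * u := by
  simp [act, frob, mulT]

theorem act_add_left (M N : F[X]) (u : Ω) : act (M + N) u = act M u + act N u := by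
  simp [act]

theorem act_sub_left (M N : F[X]) (u : Ω) : act (M - N) u = act M u - act N u := by
  simp [act]

theorem act_zero_right (M : F[X]) : act M (0 : Ω) = 0 := by simp [act]

theorem act_mul (M N : F[X]) (u : Ω) : act (M * N) u = act M (act N u) := by
  simp [act, Module.End.mul_apply]

theorem act_eq_zero_of_dvd {M N : F[X]} (h : M ∣ N) {u : Ω} (hu : act M u = 0) :
    act N u = 0 := by
  obtain ⟨D, rfl⟩ := h
  rw [mul_comm, act_mul, hu, act_zero_right]

open scoped Classical in
theorem act_gcd_eq_zero {M N : F[X]} {u : Ω} (hM : act M u = 0) (hN : act N u = 0) :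
    act (EuclideanDomain.gcd M N) u = 0 := by
  rw [EuclideanDomain.gcd_eq_gcd_ab, act_add_left, act_eq_zero_of_dvd (dvd_mul_right M _) hM,
    act_eq_zero_of_dvd (dvd_mul_right N _) hN, add_zero]

variable [IsScalarTower F (RatFunc F) Ω]

theorem act_mem (L : IntermediateField (RatFunc F) Ω) (M : F[X]) {u : Ω} (hu : u ∈ L) :
    act M u ∈ L := by
  induction M using Polynomial.induction_on' with
  | add p q hp hq => rw [act_add_left]; exact add_mem hp hq
  | monomial n a =>
    induction n with
    | zero =>
      rw [monomial_zero_left, act_C, IsScalarTower.algebraMap_apply F (RatFunc F) Ω]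
      exact mul_mem (L.algebraMap_mem _) hu
    | succ n ih =>
      rw [← X_mul_monomial, act_mul, act_X]
      exact add_mem (pow_mem ih _) (mul_mem (L.algebraMap_mem _) ih)

variable [Algebra F[X] Ω] [IsScalarTower F[X] (RatFunc F) Ω]

omit [Fintype F] in
theorem algebraMap_C (a : F) : algebraMap F[X] Ω (C a) = algebraMap F Ω a := by
  rw [IsScalarTower.algebraMap_apply F[X] (RatFunc F) Ω,
    IsScalarTower.algebraMap_apply F (RatFunc F) Ω, IsScalarTower.algebraMap_apply F F[X] (RatFunc F), Polynomial.algebraMap_eq]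

theorem act_eq_sum {M : F[X]} {n : ℕ} (hn : M.natDegree ≤ n) (u : Ω) :
    act M u = ∑ i ∈ Finset.range (n + 1),
      algebraMap F[X] Ω (carlitzCoeff M i) * u ^ Fintype.card F ^ i := by
  induction n generalizing M with
  | zero =>
    rw [eq_C_of_natDegree_le_zero hn]
    simp [act_C, carlitzCoeff_C, algebraMap_C]
  | succ n ih =>
    have hd : M.divX.natDegree ≤ n := by rw [natDegree_divX_eq_natDegree_tsub_one]; omega
    have hX : algebraMap F[X] Ω X = algebraMap (RatFunc F) Ω RatFunc.X := by
      rw [IsScalarTower.algebraMap_apply F[X] (RatFunc F) Ω, RatFunc.algebraMap_X]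
    have htop : carlitzCoeff M.divX (n + 1) = 0 := by
      rw [carlitzCoeff_of_natDegree_le hd n.le_succ, coeff_eq_zero_of_natDegree_lt (by omega), C_0]
    have hT : algebraMap (RatFunc F) Ω RatFunc.X * act M.divX u = ∑ i ∈ Finset.range (n + 2),
        algebraMap F[X] Ω (X * carlitzCoeff M.divX i) * u ^ Fintype.card F ^ i := by
      rw [ih hd, Finset.sum_range_succ _ (n + 1), htop, Finset.mul_sum]
      simp [hX, mul_assoc]
    have hφ : act M.divX u ^ Fintype.card F = ∑ i ∈ Finset.range (n + 1),
        algebraMap F[X] Ω (carlitzCoeff M.divX i ^ Fintype.card F) *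
          u ^ Fintype.card F ^ (i + 1) := by
      rw [ih hd]
      refine (map_sum (FiniteField.frobeniusAlgHom F Ω) _ _).trans ?_
      refine Finset.sum_congr rfl fun i _ => ?_
      rw [FiniteField.coe_frobeniusAlgHom]
      beta_reduce
      rw [mul_pow, map_pow, pow_succ, pow_mul]
    conv_lhs => rw [← X_mul_divX_add M, act_add_left, act_mul, act_X, act_C, hT, hφ]
    rw [carlitzCoeff_eq_of_divX M, Finset.sum_range_succ' _ (n + 1),
      Finset.sum_range_succ' _ (n + 1)]
    simp only [Pi.add_apply, leftMulT_succ, leftMulT_zero, Pi.single_eq_same, map_add, add_mul,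
      Pi.single_eq_of_ne (Nat.succ_ne_zero _), add_zero,
      Finset.sum_add_distrib, algebraMap_C, pow_zero, pow_one]
    ring

theorem aeval_carlitzPoly (M : F[X]) (u : Ω) : aeval u (carlitzPoly M) = act M u := by
  rw [act_eq_sum le_rfl, carlitzPoly, map_sum]
  simp

omit [Algebra F[X] Ω] [IsScalarTower F[X] (RatFunc F) Ω] in
theorem separable_map_carlitzPoly {M : F[X]} (hM : M ≠ 0) :
    ((carlitzPoly M).map (algebraMap F[X] (RatFunc F))).Separable := by
  rw [separable_def, derivative_map, derivative_carlitzPoly, map_C]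
  have hM' : algebraMap F[X] (RatFunc F) M ≠ 0 := by simpa using hM
  exact isCoprime_one_right.of_isCoprime_of_dvd_right (isUnit_C.2 hM'.isUnit).dvd

theorem carlitzRoots_eq_rootSet {M : F[X]} (hM : M.Monic) :
    carlitzRoots Ω M =
      ((carlitzPoly M).map (algebraMap F[X] (RatFunc F))).rootSet Ω := by
  ext u
  rw [mem_rootSet_of_ne (((monic_carlitzPoly hM).map _).ne_zero), aeval_map_algebraMap,
    aeval_carlitzPoly]
  rfl

theorem finite_carlitzRoots {M : F[X]} (hM : M.Monic) : (carlitzRoots Ω M).Finite := by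
  rw [carlitzRoots_eq_rootSet hM]
  exact rootSet_finite _ _

theorem ncard_carlitzRoots [IsAlgClosed Ω] {M : F[X]} (hM : M.Monic) :
    (carlitzRoots Ω M).ncard = Fintype.card F ^ M.natDegree := by
  rw [carlitzRoots_eq_rootSet hM, ← natDegree_carlitzPoly hM,
    ← (monic_carlitzPoly hM).natDegree_map (algebraMap F[X] (RatFunc F)),
    ← card_rootSet_eq_natDegree (K := Ω) (separable_map_carlitzPoly hM.ne_zero)
      (IsAlgClosed.splits _), ← Nat.card_eq_fintype_card, Nat.card_coe_set_eq]

/-- `Λ_{P^(n+1)}` is a cyclic `𝔽_q[T]`-module. -/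
theorem exists_generator_carlitzRoots [IsAlgClosed Ω] {P : F[X]} (hP : P.Monic)
    (hPirr : Irreducible P) (n : ℕ) :
    ∃ x : Ω, act (P ^ (n + 1)) x = 0 ∧
      ∀ v ∈ carlitzRoots Ω (P ^ (n + 1)), ∃ M : F[X], act M x = v := by
  -- Counting yields a root of exact order `P ^ (n + 1)`; it will be the generator.
  obtain ⟨x, hx, hx'⟩ : ∃ x ∈ carlitzRoots Ω (P ^ (n + 1)), x ∉ carlitzRoots Ω (P ^ n) := by
    refine Set.exists_mem_notMem_of_ncard_lt_ncard ?_ (finite_carlitzRoots (hP.pow n))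
    rw [ncard_carlitzRoots (hP.pow _), ncard_carlitzRoots (hP.pow _), hP.natDegree_pow,
      hP.natDegree_pow]
    exact Nat.pow_lt_pow_right Fintype.one_lt_card
      (Nat.mul_lt_mul_of_pos_right n.lt_succ_self hPirr.natDegree_pos)
  refine ⟨x, hx, fun v hv => ?_⟩
  classical
  have hinj (M : F[X]) (hMd : M ∈ degreeLT F (P ^ (n + 1)).natDegree) (hM : act M x = 0) :
      M = 0 := by
    obtain ⟨j, hj, hja⟩ := (dvd_prime_pow hPirr.prime (n + 1)).1 (EuclideanDomain.gcd_dvd_right M (P ^ (n + 1)))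
    have hPj := act_eq_zero_of_dvd hja.dvd (act_gcd_eq_zero hM hx)
    have hjn : n < j := by
      by_contra! h
      exact hx' (act_eq_zero_of_dvd (pow_dvd_pow P h) hPj)
    refine eq_zero_of_dvd_of_degree_lt
      (((pow_dvd_pow P hjn).trans hja.symm.dvd).trans (EuclideanDomain.gcd_dvd_left M _)) ?_
    rw [degree_eq_natDegree (pow_ne_zero _ hP.ne_zero)]
    exact mem_degreeLT.1 hMd
  -- The polynomials of degree below `deg P ^ (n + 1)` act on `x` with distinct values, as many as
  -- there are roots.
  let S : Set Ω := (fun M : F[X] => act M x) '' (degreeLT F (P ^ (n + 1)).natDegree : Set F[X])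
  have hS : S = carlitzRoots Ω (P ^ (n + 1)) := by
    refine Set.eq_of_subset_of_ncard_le ?_ ?_ (finite_carlitzRoots (hP.pow _))
    · rintro _ ⟨M, -, rfl⟩
      change act (P ^ (n + 1)) (act M x) = 0
      rw [← act_mul, mul_comm, act_mul, hx, act_zero_right]
    · rw [ncard_carlitzRoots (hP.pow _), Set.InjOn.ncard_image, ← Nat.card_coe_set_eq]
      · have := Nat.card_congr (degreeLTEquiv F (P ^ (n + 1)).natDegree).toEquiv
        simp only [SetLike.coe_sort_coe]
        rw [this]
        simp
      · intro M hM N hN h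
        refine sub_eq_zero.1 (hinj _ (sub_mem hM hN) ?_)
        rw [act_sub_left, sub_eq_zero]
        exact h
  rw [← hS] at hv
  obtain ⟨M, -, rfl⟩ := hv
  exact ⟨M, rfl⟩

theorem cyclotomicField_eq_adjoin_simple [IsAlgClosed Ω] {P : F[X]} (hP : P.Monic)
    (hPirr : Irreducible P) (n : ℕ) :
    ∃ x : Ω, act (P ^ (n + 1)) x = 0 ∧
      cyclotomicField Ω (P ^ (n + 1)) = IntermediateField.adjoin (RatFunc F) {x} := by
  obtain ⟨x, hx, h⟩ := exists_generator_carlitzRoots (Ω := Ω) hP hPirr n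
  refine ⟨x, hx, le_antisymm ?_ ?_⟩
  · refine IntermediateField.adjoin_le_iff.2 fun v hv => ?_
    obtain ⟨M, rfl⟩ := h v hv
    exact act_mem _ M (IntermediateField.mem_adjoin_simple_self _ x)
  · exact IntermediateField.adjoin.mono _ _ _ (Set.singleton_subset_iff.2 hx)

end Roots

/-! ### No new roots for primes other than `P`. -/

section Purity

variable {F : Type*} [Field F] [Fintype F]
variable {Ω : Type*} [Field Ω] [Algebra F Ω] [Algebra (RatFunc F) Ω] [IsScalarTower F (RatFunc F) Ω]
variable [Algebra F[X] Ω] [IsScalarTower F[X] (RatFunc F) Ω]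

/-- A nonzero root of `carlitzPoly Q` for an irreducible `Q` satisfies a `(Q)`-Eisenstein
equation. -/
theorem exists_eisenstein_equation {Q : F[X]} (hQ : Q.Monic) (hQirr : Irreducible Q)
    {L : Type*} [Field L] [Algebra F[X] L] {u : L} (hu0 : u ≠ 0)
    (hu : aeval u (carlitzPoly Q) = 0) (hq : 2 < Fintype.card F) :
    ∃ h : F[X][X], u ^ (Fintype.card F ^ Q.natDegree - 1) +
      algebraMap F[X] L Q * (1 + u * aeval u h) = 0 := by
  obtain ⟨e, he⟩ : ∃ e, Q.natDegree = e + 1 := ⟨Q.natDegree - 1, by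
    have := hQirr.natDegree_pos; omega⟩
  have hdvd (i : ℕ) : ∃ b, i < e → carlitzCoeff Q (i + 1) = Q * b := by
    by_cases hi : i < e
    · obtain ⟨b, hb⟩ := dvd_carlitzCoeff hQirr (by omega : i + 1 < Q.natDegree)
      exact ⟨b, fun _ => hb⟩
    · exact ⟨0, fun h => absurd h hi⟩
  choose b hb using hdvd
  -- The exponent drops by two: one factor `u` is cancelled, the other stands in front of `h(u)`.
  refine ⟨∑ i ∈ Finset.range e, C (b i) * X ^ (Fintype.card F ^ (i + 1) - 2), ?_⟩
  refine (mul_eq_zero.1 ?_).resolve_left hu0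
  have hpow (i : ℕ) : u ^ Fintype.card F ^ (i + 1) =
      u * (u * u ^ (Fintype.card F ^ (i + 1) - 2)) := by
    rw [← pow_succ', ← pow_succ']
    congr 1
    have := Nat.le_self_pow (by omega : i + 1 ≠ 0) (Fintype.card F)
    omega
  have hlead : u * u ^ (Fintype.card F ^ Q.natDegree - 1) = u ^ Fintype.card F ^ Q.natDegree := by
    rw [← pow_succ', Nat.sub_add_cancel (Nat.one_le_pow _ _ Fintype.card_pos)]
  have hsum : ∑ i ∈ Finset.range e, algebraMap F[X] L (carlitzCoeff Q (i + 1)) *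
      u ^ Fintype.card F ^ (i + 1) = u * (algebraMap F[X] L Q * (u * ∑ i ∈ Finset.range e,
        algebraMap F[X] L (b i) * u ^ (Fintype.card F ^ (i + 1) - 2))) := by
    simp only [Finset.mul_sum]
    refine Finset.sum_congr rfl fun i hi => ?_
    rw [hb i (Finset.mem_range.1 hi), hpow, map_mul]
    ring
  rw [carlitzPoly_eq_of_monic hQ] at hu
  simp only [map_add, map_sum, map_mul, map_pow, aeval_X, aeval_C] at hu ⊢
  rw [mul_add, hlead, ← hu, add_right_inj]
  conv_rhs => rw [he, Finset.sum_range_succ', hsum, carlitzCoeff_zero_right]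
  ring

/-- A Carlitz root of an irreducible `Q ≠ P` in `k(Λ_{P^(n+1)})` vanishes. -/
theorem eq_zero_of_mem_cyclotomicField [IsAlgClosed Ω] (hq : 2 < Fintype.card F) {P Q : F[X]}
    (hP : P.Monic) (hPirr : Irreducible P) (hQ : Q.Monic) (hQirr : Irreducible Q) (hPQ : Q ≠ P)
    (n : ℕ) {u : Ω} (hu : u ∈ cyclotomicField Ω (P ^ (n + 1))) (huQ : act Q u = 0) : u = 0 := by
  by_contra hu0
  obtain ⟨x, hx, hL⟩ := cyclotomicField_eq_adjoin_simple (Ω := Ω) hP hPirr n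
  rw [hL] at hu
  let L := IntermediateField.adjoin (RatFunc F) {x}
  have hmon := monic_carlitzPoly (hP.pow (n + 1))
  have hmap : aeval x ((carlitzPoly (P ^ (n + 1))).map (algebraMap F[X] (RatFunc F))) = 0 := by
    rw [aeval_map_algebraMap, aeval_carlitzPoly, hx]
  have hxint : IsIntegral (RatFunc F) x := ⟨_, hmon.map _, by rwa [← aeval_def]⟩
  have : FiniteDimensional (RatFunc F) L := IntermediateField.adjoin.finiteDimensional hxint
  have hsep : IsSeparable (RatFunc F) x :=
    (separable_map_carlitzPoly (hP.pow (n + 1)).ne_zero).of_dvd (minpoly.dvd _ _ hmap)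
  have : Algebra.IsSeparable (RatFunc F) L :=
    (IntermediateField.isSeparable_adjoin_simple_iff_isSeparable _ _).2 hsep
  have : IsScalarTower F[X] L Ω := .of_algebraMap_eq fun a => by
    rw [IsScalarTower.algebraMap_apply F[X] (RatFunc F) Ω,
      IsScalarTower.algebraMap_apply F[X] (RatFunc F) L,
      ← IsScalarTower.algebraMap_apply (RatFunc F) L Ω]
  have hval (v : L) (M : F[X]) (hv : act M (v : Ω) = 0) : aeval v (carlitzPoly M) = 0 := by
    apply (algebraMap L Ω).injective
    rw [← aeval_algebraMap_apply, map_zero, aeval_carlitzPoly]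
    exact hv
  let x' : L := IntermediateField.AdjoinSimple.gen (RatFunc F) x
  have htop : IntermediateField.adjoin (RatFunc F) {x'} = ⊤ := by
    apply IntermediateField.lift_injective L
    rw [IntermediateField.lift_adjoin_simple, IntermediateField.lift_top]
    rfl
  have huz := hval ⟨u, hu⟩ Q huQ
  have huint : IsIntegral F[X] (⟨u, hu⟩ : L) :=
    ⟨_, monic_carlitzPoly hQ, by rwa [← aeval_def]⟩
  obtain ⟨h, hh⟩ := exists_eisenstein_equation hQ hQirr
    (fun h0 => hu0 (congrArg Subtype.val h0)) huz hq
  have hQP : ¬ Q ∣ P ^ (n + 1) := fun hd =>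
    hPQ (eq_of_monic_of_associated hQ hP
      (hQirr.associated_of_dvd hPirr (hQirr.prime.dvd_of_dvd_pow hd)))
  refine not_eisenstein_root_of_derivative_eq_C (K := RatFunc F) hQirr.prime hQP hmon
    (derivative_carlitzPoly _) (hval x' _ hx) htop huint (w := aeval _ h) ?_ ?_ hh
  · exact adjoin_le_integralClosure huint (aeval_mem_adjoin_singleton F[X] _)
  -- Here `q > 2` is essential: for `q = 2` and `deg Q = 1` the Eisenstein degree would be 1.
  · have := Nat.le_self_pow hQirr.natDegree_pos.ne' (Fintype.card F)
    omega

end Purity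

/-! ### Radicality and separability. -/

section Extension

variable {F : Type*} [Field F] [Fintype F]
variable {Ω : Type*} [Field Ω] [Algebra F Ω] [Algebra (RatFunc F) Ω]

theorem cyclotomicField_mono {M N : F[X]} (h : M ∣ N) :
    cyclotomicField Ω M ≤ cyclotomicField Ω N :=
  IntermediateField.adjoin.mono _ _ _ fun _ hu => act_eq_zero_of_dvd h hu

theorem isRadical_cyclotomicField {M N : F[X]} (h : M ∣ N) (hN : N ≠ 0) :
    IsRadical (cyclotomicField Ω M) (cyclotomicField Ω N) := by
  refine ⟨carlitzRoots Ω N, fun u hu => ⟨IntermediateField.subset_adjoin _ _ hu, N, hN, ?_⟩, ?_⟩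
  · rw [show act N u = 0 from hu]
    exact zero_mem _
  · rw [IntermediateField.restrictScalars_adjoin]
    refine le_antisymm (IntermediateField.adjoin.mono _ _ _ Set.subset_union_right) ?_
    exact IntermediateField.adjoin_le_iff.2
      (Set.union_subset (cyclotomicField_mono h) (IntermediateField.subset_adjoin _ _))

variable [IsScalarTower F (RatFunc F) Ω]

theorem isSeparable_cyclotomicField [Algebra F[X] Ω] [IsScalarTower F[X] (RatFunc F) Ω]
    {M : F[X]} (hM : M.Monic) : Algebra.IsSeparable (RatFunc F) (cyclotomicField Ω M) := by
  refine (IntermediateField.isSeparable_adjoin_iff_isSeparable _ _).2 fun u hu =>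
    (separable_map_carlitzPoly hM.ne_zero).of_dvd (minpoly.dvd _ _ ?_)
  rw [aeval_map_algebraMap, aeval_carlitzPoly]
  exact hu

end Extension

end CarlitzHayes

end

theorem mainTheorem10 (F : Type*) [Field F] [Fintype F] (hq : 2 < Fintype.card F)
    (Ω : Type*) [Field Ω] [Algebra F Ω] [Algebra (RatFunc F) Ω] [IsScalarTower F (RatFunc F) Ω]
    [IsAlgClosure (RatFunc F) Ω]
    (P : F[X]) (hP : P.Monic) (hPirr : Irreducible P) (n : ℕ) (hn : 1 ≤ n) :
    CarlitzHayes.cyclotomicField Ω P ≤ CarlitzHayes.cyclotomicField Ω (P ^ n) ∧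
      CarlitzHayes.IsPure (CarlitzHayes.cyclotomicField Ω P)
        (CarlitzHayes.cyclotomicField Ω (P ^ n)) ∧
      CarlitzHayes.IsRadicalCyclotomic (CarlitzHayes.cyclotomicField Ω P)
        (CarlitzHayes.cyclotomicField Ω (P ^ n)) := by
  have : IsAlgClosed Ω := IsAlgClosure.isAlgClosed (RatFunc F)
  let : Algebra F[X] Ω :=
    ((algebraMap (RatFunc F) Ω).comp (algebraMap F[X] (RatFunc F))).toAlgebra
  have : IsScalarTower F[X] (RatFunc F) Ω := .of_algebraMap_eq fun _ => rfl
  have hdvd : P ∣ P ^ n := dvd_pow_self P (by omega)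
  have hle : CarlitzHayes.cyclotomicField Ω P ≤ CarlitzHayes.cyclotomicField Ω (P ^ n) :=
    CarlitzHayes.cyclotomicField_mono hdvd
  have hpure : CarlitzHayes.IsPure (CarlitzHayes.cyclotomicField Ω P)
      (CarlitzHayes.cyclotomicField Ω (P ^ n)) := by
    intro Q hQ hQirr u hu huQ
    obtain ⟨m, rfl⟩ : ∃ m, n = m + 1 := ⟨n - 1, by omega⟩
    by_cases hPQ : Q = P
    · exact IntermediateField.subset_adjoin _ _ (hPQ ▸ huQ)
    · rw [CarlitzHayes.eq_zero_of_mem_cyclotomicField hq hP hPirr hQ hQirr hPQ m hu huQ]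
      exact zero_mem _
  refine ⟨hle, hpure, hle, CarlitzHayes.isRadical_cyclotomicField hdvd
    (pow_ne_zero n hP.ne_zero), ?_, hpure⟩
  have : Algebra.IsSeparable (RatFunc F) (IntermediateField.extendScalars hle) :=
    CarlitzHayes.isSeparable_cyclotomicField (hP.pow n)
  exact Algebra.isSeparable_tower_top_of_isSeparable (RatFunc F)
    (CarlitzHayes.cyclotomicField Ω P) (IntermediateField.extendScalars hle)
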